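/- Let $\mathcal K$ be a finite set with $|\mathcal K|=L$, and identify probability distributions on $\mathcal K$ with vectors $p\in[0,1]^L$, $\|p\|_1=1$. For integers $s,k\ge 1$, a $\mathcal K$-decorated $(s,k)$-stochastic shape model is a function $W$ on $[0,1]^2$ of the following form: $[0,1]^2$ is cut into $s$ symmetric regions, each of which is a union of blocks of the grid of side length $1/k$, and on the $c$-th region $W$ is constant, equal to a probability vector $Q_c$ on $\mathcal K$. Let $\Theta_{s,k}$ be the set of the arrays $\boldsymbol\theta=(\boldsymbol\theta_{ij})_{i,j\in[n]}$ with $\boldsymbol\theta_{ij}=W(\xi_i,\xi_j)$, where $W$ is a $\mathcal K$-decorated $(s,k)$-stochastic shape model and $\xi_1,\dots,\xi_n\in[0,1]$. (If one prefers graphs without loops, one sets instead $\boldsymbol\theta_{ii}=\delta_{x_0}$ for all $i$, with a fixed $x_0\in\mathcal K$, in all elements of $\Theta_{s,k}$; the result holds with either convention.) Given $\boldsymbol\theta\in\Theta_{s,k}$, one observes a random symmetric matrix $\boldsymbol A\in\mathcal K^{n\times n}$ whose entries $\boldsymbol A_{ij}$, $i\le j$, are independent, $\boldsymbol A_{ij}$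 having distribution $\boldsymbol\theta_{ij}$. Let $\boldsymbol X_{ij}\in\{0,1\}^L$ be the indicator vector of the value of $\boldsymbol A_{ij}$, and let $$\widehat{\boldsymbol\theta}\in\operatorname*{argmin}_{\boldsymbol\theta'\in\Theta_{s,k}}\frac1{n^2}\sum_{i,j\in[n]}\|\boldsymbol X_{ij}-\boldsymbol\theta'_{ij}\|_2^2$$ be a least-squares estimator. Then for every $C'>0$ there is a constant $C>0$, depending only on $C'$, such that for all finite $\mathcal K$, all $s,k\ge1$, all $n>\max(0,k^2-s)$ and every $\boldsymbol\theta\in\Theta_{s,k}$, $$\frac1{n^2}\sum_{i,j\in[n]}\|\widehat{\boldsymbol\theta}_{ij}-\boldsymbol\theta_{ij}\|_2^2\le C\left(\frac{sL}{n^2}+\frac{\log(\max(k,s))}{n}\right)$$ with probability at least $1-\exp(-C'n\log s)$. Furthermore, there is a universal constant $C_1>0$ such that, for all such $\mathcal K,s,k,n$, $$\sup_{\boldsymbol\theta\in\Theta_{s,k}}\mathbb E\left[\frac1{n^2}\sum_{i,j\in[n]}\|\widehat{\boldsymbol\theta}_{ij}-\boldsymbol\theta_{ij}\|_2^2\right]\le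 C_1\left(\frac{sL}{n^2}+\frac{\log(\max(k,s))}{n}\right).$$ -/

import Mathlib

open MeasureTheory ProbabilityTheory

/-- The index of the block of length `1 / k` of the unit interval that contains `x`:
the blocks are `[a / k, (a + 1) / k)` for `a + 1 < k`, and the last one is `[(k - 1) / k, 1]`. -/
noncomputable def blockIndex (k : ℕ) [NeZero k] (x : unitInterval) : Fin k :=
  ⟨min ⌊(k : ℝ) * (x : ℝ)⌋₊ (k - 1), by
    have := Nat.pos_of_ne_zero (NeZero.ne k)
    omega⟩

/-- `W` is a `K`-decorated `(s,k)`-stochastic shape model. The unit square is cut into `s` symmetric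
regions, each of them a union of blocks of side length `1 / k`: the block with index `(a, b)` lies
in the region number `shape a b`. On the region number `c`, `W` is constant, equal to the
probability vector `Q c` on `K`. -/
def IsShapeModel {K : Type*} [Fintype K] (s k : ℕ) [NeZero k]
    (W : unitInterval → unitInterval → K → ℝ) : Prop :=
  ∃ shape : Fin k → Fin k → Fin s, (∀ a b, shape a b = shape b a) ∧
    ∃ Q : Fin s → K → ℝ, (∀ c, Q c ∈ stdSimplex ℝ K) ∧
      ∀ x y, W x y = Q (shape (blockIndex k x) (blockIndex k y))

/-- The array `θ` with `θ i j = W (ξ i) (ξ j)`. The argument `diag` selects the convention for the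
diagonal: `none` means that `θ i i = W (ξ i) (ξ i)`, and `some x₀` is the convention of graphs
without loops, where each diagonal entry is the point mass at the decoration `x₀`. -/
def probMatrix {K : Type*} [DecidableEq K] {n : ℕ} (diag : Option K)
    (W : unitInterval → unitInterval → K → ℝ) (ξ : Fin n → unitInterval) :
    Fin n → Fin n → K → ℝ :=
  fun i j => if i = j then (diag.elim (W (ξ i) (ξ j)) fun x₀ => Pi.single x₀ 1)
    else W (ξ i) (ξ j)

/-- The set `Θ_{s,k}` of the `n × n` parameter arrays of `(s,k)`-stochastic shape models. -/
def shapeParams {K : Type*} [Fintype K] [DecidableEq K] (n s k : ℕ) [NeZero k]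
    (diag : Option K) : Set (Fin n → Fin n → K → ℝ) :=
  {θ | ∃ W : unitInterval → unitInterval → K → ℝ, IsShapeModel s k W ∧
    ∃ ξ : Fin n → unitInterval, θ = probMatrix diag W ξ}

/-- The squared Frobenius distance of two `n × n × L` arrays. -/
def frobSq {K : Type*} [Fintype K] {n : ℕ} (η θ : Fin n → Fin n → K → ℝ) : ℝ :=
  ∑ i, ∑ j, ∑ l, (η i j l - θ i j l) ^ 2

/-- The mean squared error `n⁻² ∑ i j, ‖η i j - θ i j‖²`. -/
noncomputable def mse {K : Type*} [Fintype K] {n : ℕ} (η θ : Fin n → Fin n → K → ℝ) : ℝ :=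
  1 / (n : ℝ) ^ 2 * frobSq η θ

/-- The 0-1 encoding `X` of an adjacency matrix `A` with entries in `K`. -/
def oneHot {K : Type*} [DecidableEq K] {n : ℕ} (A : Fin n → Fin n → K) :
    Fin n → Fin n → K → ℝ :=
  fun i j l => if A i j = l then 1 else 0

/-- `est` is a least-squares estimator over `Θ`: it maps the adjacency matrix of a decorated graph
to a minimizer over `Θ` of the mean squared distance to its encoding. -/
def IsLeastSquaresEstimator {K : Type*} [Fintype K] [DecidableEq K] {n : ℕ}
    (Θ : Set (Fin n → Fin n → K → ℝ))
    (est : (Fin n → Fin n → K) → Fin n → Fin n → K → ℝ) : Prop :=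
  ∀ A : Fin n → Fin n → K, (∀ i j, A i j = A j i) →
    est A ∈ Θ ∧ ∀ θ ∈ Θ, mse (oneHot A) (est A) ≤ mse (oneHot A) θ

/-- The random adjacency matrix `A` of a `K`-decorated graph follows the model with parameter `θ`:
it is symmetric, its entries with `i ≤ j` are independent, and `A i j` has law `θ i j`. -/
structure IsDecoratedGraph {K Ω : Type*} [MeasurableSpace K] [MeasurableSpace Ω] {n : ℕ}
    (μ : Measure Ω) (A : Ω → Fin n → Fin n → K) (θ : Fin n → Fin n → K → ℝ) : Prop where
  measurable : ∀ i j, Measurable fun ω => A ω i j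
  symm : ∀ ω i j, A ω i j = A ω j i
  indep : iIndepFun (fun (p : {p : Fin n × Fin n // p.1 ≤ p.2}) ω => A ω p.1.1 p.1.2) μ
  law : ∀ i j l, μ.real {ω | A ω i j = l} = θ i j l

/-! Write Δ for the error of the estimator and ε for the centred one-hot noise. Minimality gives ‖ε
- Δ‖ ≤ ‖ε‖. If Δ lies in a subspace W, this forces ‖Δ‖ ≤ 2‖P_W ε‖, and sub-Gaussianity of ε bounds E
exp(‖P_W ε‖²/8) by exp(dim W). Summing over a finite family of subspaces controls E exp(‖Δ‖²/32)
(`lintegral_exp_sq_norm_le_of_mem_iUnion`); both claims follow from this single moment. The delicate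
point is the size of the family. Counting all shapes gives s^(k²), which is too many. Two regions
may be merged without leaving the subspace of the unmerged shape, so shapes matter only up to
merging. Since k² ≤ s + n, about n collisions reduce the k² blocks to s values, and (k²)^(2n) shapes
suffice (`exists_finset_forall_factor`). With the k^n block assignments the family has at most
k^(5n) members, of dimension at most sL + 1. -/

/-! ### Gaussian integrals. -/

/-- Read from right to left, this linearizes a squared norm in an exponent at the price of a
Gaussian average. -/
theorem lintegral_exp_sum_mul_gaussian {R : Type*} [Fintype R] (y : R → ℝ) :
    ∫⁻ x, ENNReal.ofReal (Real.exp (∑ r, x r * y r))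
      ∂(Measure.pi fun _ : R => gaussianReal 0 1) = ENNReal.ofReal (Real.exp (∑ r, y r ^ 2 / 2)) := by
  have hexp : Integrable (fun x : R → ℝ => ∏ r, Real.exp (y r * x r))
      (Measure.pi fun _ : R => gaussianReal 0 1) :=
    Integrable.fintype_prod (f := fun r x => Real.exp (y r * x))
      fun r => integrable_exp_mul_gaussianReal (y r)
  have hval : ∀ r, ∫ x, Real.exp (y r * x) ∂(gaussianReal 0 1) = Real.exp (y r ^ 2 / 2) := by
    intro r
    have := congrFun (mgf_fun_id_gaussianReal (μ := 0) (v := 1)) (y r)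
    simpa [mgf] using this
  have h := integral_fintype_prod_eq_prod (μ := fun _ : R => gaussianReal 0 1)
    (fun r x => Real.exp (y r * x))
  simp_rw [hval, ← Real.exp_sum] at h
  simp_rw [← Real.exp_sum] at hexp
  rw [← h, ofReal_integral_eq_lintegral_ofReal hexp (ae_of_all _ fun x => (Real.exp_pos _).le)]
  simp_rw [mul_comm]

theorem integrable_exp_sq_gaussian :
    Integrable (fun x : ℝ => Real.exp (x ^ 2 / 4)) (gaussianReal 0 1) ∧
      ∫ x, Real.exp (x ^ 2 / 4) ∂(gaussianReal 0 1) = √2 := by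
  have hpdf : ∀ x : ℝ, gaussianPDFReal 0 1 x • Real.exp (x ^ 2 / 4)
      = (√(2 * Real.pi))⁻¹ * Real.exp (-(1 / 4) * x ^ 2) := by
    intro x
    simp only [gaussianPDFReal, NNReal.coe_one, mul_one, sub_zero, smul_eq_mul, mul_assoc,
      ← Real.exp_add]
    ring_nf
  constructor
  · rw [gaussianReal_of_var_ne_zero _ one_ne_zero,
      integrable_withDensity_iff_integrable_smul' (measurable_gaussianPDF _ _)
        (ae_of_all _ fun _ => gaussianPDF_lt_top)]
    simp only [toReal_gaussianPDF]
    simp_rw [hpdf]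
    exact (integrable_exp_neg_mul_sq (by norm_num)).const_mul _
  · rw [integral_gaussianReal_eq_integral_smul one_ne_zero]
    simp_rw [hpdf]
    rw [integral_const_mul, integral_gaussian, ← Real.sqrt_inv, ← Real.sqrt_mul (by positivity)]
    congr 1
    field_simp
    norm_num

theorem lintegral_exp_sum_sq_gaussian_le {R : Type*} [Fintype R] :
    ∫⁻ x, ENNReal.ofReal (Real.exp (∑ r, x r ^ 2 / 4)) ∂(Measure.pi fun _ : R => gaussianReal 0 1)
      ≤ ENNReal.ofReal (Real.exp (Fintype.card R)) := by
  have hexp : Integrable (fun x : R → ℝ => ∏ r, Real.exp (x r ^ 2 / 4))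
      (Measure.pi fun _ : R => gaussianReal 0 1) :=
    Integrable.fintype_prod (f := fun _ x => Real.exp (x ^ 2 / 4))
      fun _ => integrable_exp_sq_gaussian.1
  have h := integral_fintype_prod_eq_pow (ι := R) (μ := gaussianReal 0 1)
    (fun x => Real.exp (x ^ 2 / 4))
  rw [integrable_exp_sq_gaussian.2] at h
  simp_rw [← Real.exp_sum] at hexp h
  rw [← ofReal_integral_eq_lintegral_ofReal hexp (ae_of_all _ fun x => (Real.exp_pos _).le), h,
    ← mul_one (Fintype.card R : ℝ), Real.exp_nat_mul]
  refine ENNReal.ofReal_le_ofReal (pow_le_pow_left₀ (Real.sqrt_nonneg _) ?_ _)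
  rw [Real.sqrt_le_left (Real.exp_pos _).le]
  nlinarith [Real.add_one_le_exp 1]

/-! ### Projections of sub-Gaussian vectors and the basic inequality. -/

section SubGaussianVector

variable {Ω H : Type*} [MeasurableSpace Ω] {μ : Measure Ω} [IsProbabilityMeasure μ]
  [NormedAddCommGroup H] [InnerProductSpace ℝ H] {ε : Ω → H}

/-- A sub-Gaussian random vector has an exponentially integrable squared projection on every
finite-dimensional subspace, at the rate given by the dimension. -/
theorem lintegral_exp_sq_norm_starProjection_le (W : Submodule ℝ H) [FiniteDimensional ℝ W]
    (hm : ∀ v, Measurable fun ω => inner ℝ v (ε ω))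
    (hε : ∀ v, ∫⁻ ω, ENNReal.ofReal (Real.exp (inner ℝ v (ε ω))) ∂μ
      ≤ ENNReal.ofReal (Real.exp (‖v‖ ^ 2))) :
    ∫⁻ ω, ENNReal.ofReal (Real.exp (‖W.starProjection (ε ω)‖ ^ 2 / 8)) ∂μ
      ≤ ENNReal.ofReal (Real.exp (Module.finrank ℝ W)) := by
  let b := stdOrthonormalBasis ℝ W
  let γ := Measure.pi fun _ : Fin (Module.finrank ℝ W) => gaussianReal 0 1
  -- The factor 1/2 keeps the Gaussian integral finite: the sub-Gaussian bound then produces exp(∑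
  -- x_r²/4), whereas unscaled coordinates would produce exp(∑ x_r²).
  have hproj : ∀ ω, ‖W.starProjection (ε ω)‖ ^ 2 / 8
      = ∑ r, (inner ℝ (b r : H) (ε ω) / 2) ^ 2 / 2 := by
    intro ω
    rw [Submodule.starProjection_apply, Submodule.norm_coe, ← b.sum_sq_norm_inner_right,
      Finset.sum_div]
    refine Finset.sum_congr rfl fun r _ => ?_
    rw [Submodule.inner_orthogonalProjectionOnto_eq_of_mem_left, Real.norm_eq_abs, sq_abs]
    ring
  have hcomb : ∀ (x : Fin (Module.finrank ℝ W) → ℝ) ω,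
      ∑ r, x r * (inner ℝ (b r : H) (ε ω) / 2)
        = inner ℝ ((∑ r, (x r / 2) • b r : W) : H) (ε ω) := by
    intro x ω
    simp only [Submodule.coe_sum, Submodule.coe_smul, sum_inner, real_inner_smul_left]
    exact Finset.sum_congr rfl fun r _ => by ring
  have hnorm : ∀ x : Fin (Module.finrank ℝ W) → ℝ,
      ‖((∑ r, (x r / 2) • b r : W) : H)‖ ^ 2 = ∑ r, x r ^ 2 / 4 := by
    intro x
    rw [Submodule.norm_coe, ← real_inner_self_eq_norm_sq, b.orthonormal.inner_sum]
    refine Finset.sum_congr rfl fun r _ => ?_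
    simp only [conj_trivial]
    ring
  calc ∫⁻ ω, ENNReal.ofReal (Real.exp (‖W.starProjection (ε ω)‖ ^ 2 / 8)) ∂μ
      = ∫⁻ ω, ∫⁻ x, ENNReal.ofReal (Real.exp (∑ r, x r * (inner ℝ (b r : H) (ε ω) / 2))) ∂γ ∂μ :=
        lintegral_congr fun ω => by rw [hproj, lintegral_exp_sum_mul_gaussian]
    _ = ∫⁻ x, ∫⁻ ω, ENNReal.ofReal (Real.exp (∑ r, x r * (inner ℝ (b r : H) (ε ω) / 2))) ∂μ ∂γ := by
        refine lintegral_lintegral_swap (Measurable.aemeasurable ?_)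
        refine (Real.measurable_exp.comp (Finset.measurable_sum _ fun r _ => ?_)).ennreal_ofReal
        exact ((measurable_pi_apply r).comp measurable_snd).mul
          (((hm (b r)).comp measurable_fst).div_const 2)
    _ ≤ ∫⁻ x, ENNReal.ofReal (Real.exp (∑ r, x r ^ 2 / 4)) ∂γ := by
        refine lintegral_mono fun x => ?_
        simp_rw [hcomb, ← hnorm]
        exact hε _
    _ ≤ _ := by
        simpa using lintegral_exp_sum_sq_gaussian_le (R := Fin (Module.finrank ℝ W))

/-- Expanding the square gives ‖Δ‖² ≤ 2⟨e, Δ⟩ = 2⟨P_W e, Δ⟩, and Cauchy–Schwarz concludes. -/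
theorem norm_sq_le_of_norm_sq_le_inner (W : Submodule ℝ H) [W.HasOrthogonalProjection] {Δ e : H}
    (hΔ : Δ ∈ W) (h : ‖e - Δ‖ ^ 2 ≤ ‖e‖ ^ 2) : ‖Δ‖ ^ 2 ≤ 4 * ‖W.starProjection e‖ ^ 2 := by
  rw [norm_sub_sq_real] at h
  have hin : inner ℝ e Δ = inner ℝ (W.starProjection e) Δ := by
    conv_lhs => rw [← Submodule.starProjection_eq_self_iff.2 hΔ]
    rw [Submodule.inner_starProjection_left_eq_right]
  have hcs := real_inner_le_norm (W.starProjection e) Δ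
  nlinarith [sq_nonneg (‖Δ‖ - 2 * ‖W.starProjection e‖)]

/-- The basic inequality for least squares over a finite union of subspaces. -/
theorem lintegral_exp_sq_norm_le_of_mem_iUnion {ι : Type*} (s : Finset ι) (W : ι → Submodule ℝ H)
    [∀ i, FiniteDimensional ℝ (W i)] {d : ℝ} (hd : ∀ i ∈ s, (Module.finrank ℝ (W i) : ℝ) ≤ d)
    (hm : ∀ v, Measurable fun ω => inner ℝ v (ε ω))
    (hε : ∀ v, ∫⁻ ω, ENNReal.ofReal (Real.exp (inner ℝ v (ε ω))) ∂μ
      ≤ ENNReal.ofReal (Real.exp (‖v‖ ^ 2)))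
    (Δ : Ω → H) (hΔ : ∀ ω, ∃ i ∈ s, Δ ω ∈ W i) (hmin : ∀ ω, ‖ε ω - Δ ω‖ ^ 2 ≤ ‖ε ω‖ ^ 2) :
    ∫⁻ ω, ENNReal.ofReal (Real.exp (‖Δ ω‖ ^ 2 / 32)) ∂μ
      ≤ ENNReal.ofReal (s.card * Real.exp d) := by
  have hmeas : ∀ i, Measurable fun ω =>
      ENNReal.ofReal (Real.exp (‖(W i).starProjection (ε ω)‖ ^ 2 / 8)) := by
    intro i
    let b := stdOrthonormalBasis ℝ (W i)
    have hproj : ∀ ω, ‖(W i).starProjection (ε ω)‖ ^ 2 = ∑ r, inner ℝ (b r : H) (ε ω) ^ 2 := by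
      intro ω
      rw [Submodule.starProjection_apply, Submodule.norm_coe, ← b.sum_sq_norm_inner_right]
      refine Finset.sum_congr rfl fun r _ => ?_
      rw [Submodule.inner_orthogonalProjectionOnto_eq_of_mem_left, Real.norm_eq_abs, sq_abs]
    simp_rw [hproj]
    exact (Real.measurable_exp.comp
      ((Finset.measurable_sum _ fun r _ => (hm (b r)).pow_const 2).div_const 8)).ennreal_ofReal
  calc ∫⁻ ω, ENNReal.ofReal (Real.exp (‖Δ ω‖ ^ 2 / 32)) ∂μ
      ≤ ∫⁻ ω, ∑ i ∈ s, ENNReal.ofReal (Real.exp (‖(W i).starProjection (ε ω)‖ ^ 2 / 8)) ∂μ := by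
        -- The random index is handled by summing over all indices; monotonicity of the lower
        -- integral needs no measurability of `Δ`.
        refine lintegral_mono fun ω => ?_
        obtain ⟨i, hi, hmem⟩ := hΔ ω
        refine le_trans (ENNReal.ofReal_le_ofReal (Real.exp_le_exp.2 ?_))
          (Finset.single_le_sum (f := fun i =>
            ENNReal.ofReal (Real.exp (‖(W i).starProjection (ε ω)‖ ^ 2 / 8)))
            (fun _ _ => zero_le) hi)
        linarith [norm_sq_le_of_norm_sq_le_inner (W i) hmem (hmin ω)]
    _ = ∑ i ∈ s, ∫⁻ ω, ENNReal.ofReal (Real.exp (‖(W i).starProjection (ε ω)‖ ^ 2 / 8)) ∂μ :=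
        lintegral_finsetSum _ fun i _ => hmeas i
    _ ≤ ∑ i ∈ s, ENNReal.ofReal (Real.exp d) := by
        refine Finset.sum_le_sum fun i hi =>
          (lintegral_exp_sq_norm_starProjection_le (W i) hm hε).trans ?_
        exact ENNReal.ofReal_le_ofReal (Real.exp_le_exp.2 (hd i hi))
    _ = _ := by
        rw [Finset.sum_const, nsmul_eq_mul, ENNReal.ofReal_mul (by positivity),
          ENNReal.ofReal_natCast]

end SubGaussianVector

/-- Up to merging of values, few maps suffice to represent all maps from a set with `s + m`
elements to a set with `s` elements. -/
theorem exists_finset_forall_factor (s m : ℕ) (T : Type) [Fintype T] [DecidableEq T] [Nonempty T]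
    (hT : Fintype.card T ≤ s + m) :
    ∃ S : Finset (T → Fin s), S.card ≤ Fintype.card T ^ (2 * m) ∧
      ∀ f : T → Fin s, ∃ g ∈ S, ∃ h : Fin s → Fin s, f = h ∘ g := by
  induction m generalizing T with
  | zero =>
    obtain ⟨g⟩ : Nonempty (T ↪ Fin s) :=
      Function.Embedding.nonempty_of_card_le (by simpa using hT)
    -- With at most `s` points, a single injection represents every map.
    exact ⟨{⇑g}, by simp, fun f => ⟨g, by simp, f ∘ Function.invFun g, by
      rw [Function.comp_assoc, Function.invFun_comp g.injective, Function.comp_id]⟩⟩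
  | succ m ih =>
    have hpos : 0 < Fintype.card T := Fintype.card_pos
    by_cases hs : Fintype.card T ≤ s + m
    · obtain ⟨S, hS, hf⟩ := ih T hs
      exact ⟨S, hS.trans (Nat.pow_le_pow_right hpos (by omega)), hf⟩
    -- By pigeonhole `f` identifies some a ≠ b, so it is determined on `T` without b. The |T|²
    -- choices of the pair account for the exponent 2 per step.
    · have hex : ∀ p : T × T, ∃ S : Finset (T → Fin s),
          S.card ≤ Fintype.card T ^ (2 * m) ∧ (p.1 ≠ p.2 → ∀ f : T → Fin s, f p.1 = f p.2 →
            ∃ g ∈ S, ∃ h : Fin s → Fin s, f = h ∘ g) := by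
        rintro ⟨a, b⟩
        by_cases hab : a = b
        · exact ⟨∅, by simp, fun h => absurd hab h⟩
        have : Nonempty {x // x ≠ b} := ⟨⟨a, hab⟩⟩
        have hcard : Fintype.card {x // x ≠ b} = Fintype.card T - 1 := by
          simp [Fintype.card_subtype_compl]
        obtain ⟨S, hS, hf⟩ := ih {x // x ≠ b} (by omega)
        let π : T → {x // x ≠ b} := fun x => if hx : x = b then ⟨a, hab⟩ else ⟨x, hx⟩
        refine ⟨S.image (· ∘ π), Finset.card_image_le.trans (hS.trans ?_), fun _ f hfab => ?_⟩
        · exact Nat.pow_le_pow_left (by omega) _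
        · obtain ⟨g, hg, h, hgh⟩ := hf (f ∘ Subtype.val)
          refine ⟨g ∘ π, Finset.mem_image_of_mem _ hg, h, ?_⟩
          rw [← Function.comp_assoc, ← hgh]
          funext x
          by_cases hx : x = b
          · simpa [π, hx] using hfab.symm
          · simp [π, hx]
      choose S hS hf using hex
      refine ⟨Finset.univ.biUnion S, ?_, fun f => ?_⟩
      · refine (Finset.card_biUnion_le_card_mul _ _ _ fun p _ => hS p).trans ?_
        rw [Finset.card_univ, Fintype.card_prod]
        exact le_of_eq (by ring)
      · obtain ⟨a, b, hab, hfab⟩ := Fintype.exists_ne_map_eq_of_card_lt f (by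
          rw [Fintype.card_fin]; omega)
        obtain ⟨g, hg, h⟩ := hf (a, b) hab f hfab
        exact ⟨g, Finset.mem_biUnion.2 ⟨_, Finset.mem_univ _, hg⟩, h⟩

/-! ### Sub-Gaussianity of the one-hot noise. -/

theorem sum_sum_eq_sum_le {n : ℕ} (f : Fin n → Fin n → ℝ) :
    ∑ i, ∑ j, f i j = ∑ p : {p : Fin n × Fin n // p.1 ≤ p.2},
      (f p.1.1 p.1.2 + if p.1.1 = p.1.2 then 0 else f p.1.2 p.1.1) := by
  have hsub : ∀ F : Fin n × Fin n → ℝ, ∑ p : {p : Fin n × Fin n // p.1 ≤ p.2}, F p.1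
      = ∑ i, ∑ j, if i ≤ j then F (i, j) else 0 := by
    intro F
    rw [← Fintype.sum_prod_type' (f := fun i j => if i ≤ j then F (i, j) else 0),
      ← Finset.sum_filter, Finset.sum_subtype (p := fun p : Fin n × Fin n => p.1 ≤ p.2)]
    simp
  rw [hsub fun p => f p.1 p.2 + if p.1 = p.2 then 0 else f p.2 p.1]
  have hsplit : ∀ i j : Fin n, (if i ≤ j then f i j + (if i = j then 0 else f j i) else 0)
      = (if i ≤ j then f i j else 0) + if i < j then f j i else 0 := by
    intro i j
    rcases lt_trichotomy i j with h | h | h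
    · simp [h, h.le, h.ne]
    · simp [h]
    · simp [h.not_ge, h.not_gt]
  simp only [hsplit, Finset.sum_add_distrib]
  rw [Finset.sum_comm (f := fun i j => if i < j then f j i else 0), ← Finset.sum_add_distrib]
  refine Finset.sum_congr rfl fun i _ => ?_
  rw [← Finset.sum_add_distrib]
  refine Finset.sum_congr rfl fun j _ => ?_
  rcases le_or_gt i j with h | h
  · simp [h, h.not_gt]
  · simp [h, h.not_ge]

section

variable {K Ω : Type*} [Fintype K] [DecidableEq K] [MeasurableSpace K] [DiscreteMeasurableSpace K]
  [MeasurableSpace Ω] {μ : Measure Ω} [IsProbabilityMeasure μ]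

/-- The sum is w(a) minus its mean, and |w(a)| ≤ ‖w‖₂, so Hoeffding's lemma gives a parameter free
of any factor |K|. -/
theorem hasSubgaussianMGF_sum_indicator {a : Ω → K} (ha : Measurable a) (w : K → ℝ) :
    HasSubgaussianMGF (fun ω => ∑ l, ((if a ω = l then 1 else 0) - μ.real {ω | a ω = l}) * w l)
      (Real.toNNReal (∑ l, w l ^ 2)) μ := by
  set R := √(∑ l, w l ^ 2)
  have hR : 0 ≤ R := Real.sqrt_nonneg _
  have hm : Measurable fun ω => w (a ω) := (measurable_of_countable w).comp ha
  have hb : ∀ᵐ ω ∂μ, w (a ω) ∈ Set.Icc (-R) R := ae_of_all _ fun ω => abs_le.1 <|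
    Real.abs_le_sqrt (Finset.single_le_sum (f := fun l => w l ^ 2) (fun _ _ => sq_nonneg _)
      (Finset.mem_univ _))
  have hmean : ∫ ω, w (a ω) ∂μ = ∑ l, μ.real {ω | a ω = l} * w l := by
    have : IsProbabilityMeasure (μ.map a) := Measure.isProbabilityMeasure_map ha.aemeasurable
    rw [← integral_map (f := w) ha.aemeasurable (measurable_of_countable w).aestronglyMeasurable,
      integral_fintype (Integrable.of_finite)]
    refine Finset.sum_congr rfl fun l _ => ?_
    rw [map_measureReal_apply ha (measurableSet_singleton l)]
    rfl
  convert hasSubgaussianMGF_of_mem_Icc hm.aemeasurable hb using 1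
  · funext ω
    simp [hmean, sub_mul, Finset.sum_sub_distrib]
  · ext
    have : R - -R = 2 * R := by ring
    rw [this]
    simp only [NNReal.coe_pow, NNReal.coe_div, coe_nnnorm, NNReal.coe_ofNat]
    rw [Real.coe_toNNReal _ (Finset.sum_nonneg fun _ _ => sq_nonneg _), Real.norm_eq_abs,
      abs_of_nonneg (by positivity), mul_div_cancel_left₀ _ two_ne_zero,
      Real.sq_sqrt (Finset.sum_nonneg fun _ _ => sq_nonneg _)]

variable {n : ℕ} {A : Ω → Fin n → Fin n → K} {θ : Fin n → Fin n → K → ℝ}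

theorem IsDecoratedGraph.lintegral_exp_le (hA : IsDecoratedGraph μ A θ)
    (v : Fin n → Fin n → K → ℝ) :
    ∫⁻ ω, ENNReal.ofReal (Real.exp (∑ i, ∑ j, ∑ l, (oneHot (A ω) i j l - θ i j l) * v i j l)) ∂μ
      ≤ ENNReal.ofReal (Real.exp (∑ i, ∑ j, ∑ l, v i j l ^ 2)) := by
  have hsymm : ∀ i j l, θ i j l = θ j i l := fun i j l => by
    rw [← hA.law, ← hA.law]; simp_rw [hA.symm _ i j]
  let w : {p : Fin n × Fin n // p.1 ≤ p.2} → K → ℝ := fun p l =>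
    v p.1.1 p.1.2 l + if p.1.1 = p.1.2 then 0 else v p.1.2 p.1.1 l
  have hsum : ∀ ω, ∑ i, ∑ j, ∑ l, (oneHot (A ω) i j l - θ i j l) * v i j l
      = ∑ p : {p : Fin n × Fin n // p.1 ≤ p.2}, ∑ l, ((if A ω p.1.1 p.1.2 = l then 1 else 0)
        - μ.real {ω | A ω p.1.1 p.1.2 = l}) * w p l := by
    intro ω
    rw [sum_sum_eq_sum_le fun i j => ∑ l, (oneHot (A ω) i j l - θ i j l) * v i j l]
    refine Finset.sum_congr rfl fun p _ => ?_
    simp only [w, mul_add, Finset.sum_add_distrib, hA.law, oneHot]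
    congr 1
    split_ifs with h
    · simp
    · exact Finset.sum_congr rfl fun l _ => by rw [hsymm p.1.2 p.1.1 l, hA.symm ω p.1.2 p.1.1]
  -- Each off-diagonal entry occurs twice, which costs a factor 2; it cancels the 1/2 of the
  -- sub-Gaussian bound.
  have hnorm : ∑ p, ∑ l, w p l ^ 2 ≤ 2 * ∑ i, ∑ j, ∑ l, v i j l ^ 2 := by
    rw [sum_sum_eq_sum_le fun i j => ∑ l, v i j l ^ 2, Finset.mul_sum]
    refine Finset.sum_le_sum fun p _ => ?_
    simp only [w]
    split_ifs with h
    · simp only [add_zero]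
      linarith [Finset.sum_nonneg fun l (_ : l ∈ Finset.univ) => sq_nonneg (v p.1.1 p.1.2 l)]
    · rw [← Finset.sum_add_distrib, Finset.mul_sum]
      exact Finset.sum_le_sum fun l _ => by
        nlinarith [sq_nonneg (v p.1.1 p.1.2 l - v p.1.2 p.1.1 l)]
  have hindep : iIndepFun (fun (p : {p : Fin n × Fin n // p.1 ≤ p.2}) ω =>
      ∑ l, ((if A ω p.1.1 p.1.2 = l then 1 else 0)
        - μ.real {ω | A ω p.1.1 p.1.2 = l}) * w p l) μ :=
    hA.indep.comp (fun p a => ∑ l, ((if a = l then 1 else 0)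
      - μ.real {ω | A ω p.1.1 p.1.2 = l}) * w p l) fun _ => measurable_of_countable _
  have hsub := HasSubgaussianMGF.sum_of_iIndepFun hindep (s := Finset.univ)
    (c := fun p => Real.toNNReal (∑ l, w p l ^ 2))
    fun p _ => hasSubgaussianMGF_sum_indicator (hA.measurable p.1.1 p.1.2) (w p)
  have hexp := hsub.integrable_exp_mul 1
  have hmgf := hsub.mgf_le 1
  simp only [mgf, one_mul, ← hsum] at hexp hmgf
  rw [← ofReal_integral_eq_lintegral_ofReal hexp (ae_of_all _ fun _ => (Real.exp_pos _).le)]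
  refine ENNReal.ofReal_le_ofReal (hmgf.trans (Real.exp_le_exp.2 ?_))
  rw [NNReal.coe_sum]
  simp_rw [Real.coe_toNNReal _ (Finset.sum_nonneg fun _ _ => sq_nonneg _)]
  linarith

end

/-! ### The parameter set as a union of few affine families. -/

section Model

variable {K : Type*} [Fintype K] {n s k : ℕ}

/-- An array with entries in `K → ℝ` as a vector of the Euclidean space. -/
noncomputable def arrayVec (η : Fin n → Fin n → K → ℝ) : EuclideanSpace ℝ (Fin n × Fin n × K) :=
  WithLp.toLp 2 fun p => η p.1 p.2.1 p.2.2

/-- The array which is constant on the classes of pairs given by `c`, with value `Q`, and which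
vanishes on the diagonal if the diagonal is fixed by convention. -/
noncomputable def classArray (diag : Option K) (c : Fin n → Fin n → Fin s) :
    (Fin s × K → ℝ) →ₗ[ℝ] EuclideanSpace ℝ (Fin n × Fin n × K) where
  toFun Q := arrayVec fun i j l => if i = j ∧ diag.isSome then 0 else Q (c i j, l)
  map_add' Q Q' := by
    ext p
    simp only [arrayVec, PiLp.add_apply, Pi.add_apply]
    split_ifs <;> simp
  map_smul' r Q := by
    ext p
    simp only [arrayVec, PiLp.smul_apply, Pi.smul_apply, RingHom.id_apply]
    split_ifs <;> simp

theorem norm_sq_arrayVec (η : Fin n → Fin n → K → ℝ) :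
    ‖arrayVec η‖ ^ 2 = ∑ i, ∑ j, ∑ l, η i j l ^ 2 := by
  simp only [EuclideanSpace.norm_sq_eq, arrayVec, Real.norm_eq_abs, sq_abs, Fintype.sum_prod_type]

theorem norm_sq_arrayVec_sub (η θ : Fin n → Fin n → K → ℝ) :
    ‖arrayVec η - arrayVec θ‖ ^ 2 = frobSq η θ :=
  norm_sq_arrayVec fun i j l => η i j l - θ i j l

theorem inner_arrayVec_sub (v : EuclideanSpace ℝ (Fin n × Fin n × K))
    (η θ : Fin n → Fin n → K → ℝ) :
    inner ℝ v (arrayVec η - arrayVec θ)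
      = ∑ i, ∑ j, ∑ l, (η i j l - θ i j l) * v (i, j, l) := by
  simp [PiLp.inner_apply, arrayVec, Fintype.sum_prod_type]

/-- The offset from the diagonal convention is common to all parameters and cancels in differences.
-/
theorem exists_arrayVec_eq_of_mem_shapeParams [DecidableEq K] [NeZero k] (diag : Option K)
    {θ : Fin n → Fin n → K → ℝ} (hθ : θ ∈ shapeParams n s k diag) :
    ∃ (z : Fin n → Fin k) (f : Fin k × Fin k → Fin s) (Q : Fin s × K → ℝ),
      arrayVec θ = classArray diag (fun i j => f (z i, z j)) Q + arrayVec fun i j l =>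
        if i = j then diag.elim 0 (fun x₀ => (Pi.single x₀ 1 : K → ℝ) l) else 0 := by
  obtain ⟨W, ⟨shape, -, Q, -, hW⟩, ξ, rfl⟩ := hθ
  refine ⟨fun i => blockIndex k (ξ i), fun p => shape p.1 p.2, fun p => Q p.1 p.2, ?_⟩
  ext ⟨i, j, l⟩
  simp only [arrayVec, classArray, probMatrix, LinearMap.coe_mk, AddHom.coe_mk, PiLp.add_apply, hW]
  by_cases hij : i = j
  · cases diag <;> simp [hij]
  · simp [hij]

/-- The true parameter is fixed, so subtracting it adds only one dimension, the line spanned by its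
linear part. -/
theorem exists_card_le_forall_sub_mem [DecidableEq K] [NeZero k] (hk : k ^ 2 ≤ s + n)
    (diag : Option K) {θ : Fin n → Fin n → K → ℝ} (hθ : θ ∈ shapeParams n s k diag) :
    ∃ (S : Finset ((Fin n → Fin k) × (Fin k × Fin k → Fin s)))
      (W : (Fin n → Fin k) × (Fin k × Fin k → Fin s) →
        Submodule ℝ (EuclideanSpace ℝ (Fin n × Fin n × K))),
      S.card ≤ k ^ (5 * n) ∧
      (∀ i, Module.finrank ℝ (W i) ≤ s * Fintype.card K + 1) ∧
      ∀ η ∈ shapeParams n s k diag, ∃ i ∈ S, arrayVec η - arrayVec θ ∈ W i := by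
  have : Nonempty (Fin k × Fin k) := ⟨(0, 0)⟩
  obtain ⟨S, hS, hf⟩ := exists_finset_forall_factor s n (Fin k × Fin k) (by
    simpa [← sq] using hk)
  obtain ⟨z₀, f₀, Q₀, h₀⟩ := exists_arrayVec_eq_of_mem_shapeParams diag hθ
  set u := classArray diag (fun i j => f₀ (z₀ i, z₀ j)) Q₀
  refine ⟨Finset.univ ×ˢ S, fun p => LinearMap.range (classArray diag fun i j => p.2 (p.1 i, p.1 j))
    ⊔ Submodule.span ℝ {u}, ?_, fun p => ?_, fun η hη => ?_⟩
  · rw [Finset.card_product, Finset.card_univ, Fintype.card_fun, Fintype.card_fin, Fintype.card_fin]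
    refine (Nat.mul_le_mul_left _ hS).trans (le_of_eq ?_)
    simp only [Fintype.card_prod, Fintype.card_fin]
    ring
  · refine (Submodule.finrank_add_le_finrank_add_finrank _ _).trans (add_le_add ?_ ?_)
    · refine (LinearMap.finrank_range_le _).trans (le_of_eq ?_)
      simp
    · exact (finrank_span_le_card {u}).trans (by simp)
  · obtain ⟨z, f, Q, h⟩ := exists_arrayVec_eq_of_mem_shapeParams diag hη
    obtain ⟨g, hg, σ, rfl⟩ := hf f
    refine ⟨(z, g), by simp [hg], ?_⟩
    rw [h, h₀, add_sub_add_right_eq_sub]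
    -- The merging map `σ` is absorbed into the values: Q ∘ σ is another choice of values on the
    -- classes of `g`.
    refine sub_mem (Submodule.mem_sup_left ⟨fun p => Q (σ p.1, p.2), rfl⟩)
      (Submodule.mem_sup_right (Submodule.mem_span_singleton_self u))

end Model

/-! ### Exponential moment and risk bounds. -/

section

variable {K Ω : Type*} [Fintype K] [MeasurableSpace K] [DiscreteMeasurableSpace K]
  [MeasurableSpace Ω] {μ : Measure Ω} [IsProbabilityMeasure μ]
  {n s k : ℕ} {A : Ω → Fin n → Fin n → K} {θ : Fin n → Fin n → K → ℝ}

/-- `A` takes finitely many values, so the estimator needs no measurability assumption. -/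
theorem IsDecoratedGraph.integrable_comp (hA : IsDecoratedGraph μ A θ)
    (f : (Fin n → Fin n → K) → ℝ) : Integrable (fun ω => f (A ω)) μ := by
  have hm : Measurable A := measurable_pi_lambda _ fun i => measurable_pi_lambda _ fun j =>
    hA.measurable i j
  have : IsProbabilityMeasure (μ.map A) := Measure.isProbabilityMeasure_map hm.aemeasurable
  exact (Integrable.of_finite (μ := μ.map A) (f := f)).comp_measurable hm

/-- The exponential moment of the loss of the least-squares estimator. -/
theorem IsDecoratedGraph.integral_exp_frobSq_le [DecidableEq K] [NeZero k] (hs : 0 < s)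
    (hn : 0 < n) (hk : k ^ 2 ≤ s + n) {diag : Option K}
    {est : (Fin n → Fin n → K) → Fin n → Fin n → K → ℝ}
    (hest : IsLeastSquaresEstimator (shapeParams n s k diag) est)
    (hθ : θ ∈ shapeParams n s k diag) (hA : IsDecoratedGraph μ A θ) :
    ∫ ω, Real.exp (frobSq (est (A ω)) θ / 32) ∂μ
      ≤ Real.exp (5 * (n * Real.log (max k s) + s * Fintype.card K)) := by
  obtain ⟨S, W, hS, hW, hmem⟩ := exists_card_le_forall_sub_mem hk diag hθ
  obtain ⟨ω₀⟩ : Nonempty Ω := nonempty_of_isProbabilityMeasure μ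
  have : Nonempty K := ⟨A ω₀ ⟨0, hn⟩ ⟨0, hn⟩⟩
  -- This absorbs the extra dimension: sL + 1 ≤ 2sL ≤ 5sL.
  have hL : (1 : ℝ) ≤ s * Fintype.card K := by
    exact_mod_cast Nat.mul_pos hs Fintype.card_pos
  have hk0 : (0 : ℝ) < k := by exact_mod_cast Nat.pos_of_ne_zero (NeZero.ne k)
  have hmain := lintegral_exp_sq_norm_le_of_mem_iUnion (μ := μ)
    (ε := fun ω => arrayVec (oneHot (A ω)) - arrayVec θ) S W
    (d := s * Fintype.card K + 1) (fun i _ => by exact_mod_cast hW i)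
    (fun v => by
      simp_rw [inner_arrayVec_sub]
      have hm : Measurable A := measurable_pi_lambda _ fun i => measurable_pi_lambda _ fun j =>
        hA.measurable i j
      exact (measurable_of_countable fun a : Fin n → Fin n → K =>
        ∑ i, ∑ j, ∑ l, (oneHot a i j l - θ i j l) * v (i, j, l)).comp hm)
    (fun v => by
      simp_rw [inner_arrayVec_sub]
      refine (hA.lintegral_exp_le fun i j l => v (i, j, l)).trans (le_of_eq ?_)
      rw [← norm_sq_arrayVec]
      rfl)
    (fun ω => arrayVec (est (A ω)) - arrayVec θ)
    (fun ω => hmem _ (hest (A ω) (hA.symm ω)).1)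
    (fun ω => by
      rw [sub_sub_sub_cancel_right, norm_sq_arrayVec_sub, norm_sq_arrayVec_sub]
      have h := (hest (A ω) (hA.symm ω)).2 θ hθ
      exact le_of_mul_le_mul_left h (by positivity))
  simp_rw [norm_sq_arrayVec_sub] at hmain
  rw [← ofReal_integral_eq_lintegral_ofReal
    (hA.integrable_comp fun a => Real.exp (frobSq (est a) θ / 32))
    (ae_of_all _ fun _ => (Real.exp_pos _).le), ENNReal.ofReal_le_ofReal_iff (by positivity)] at hmain
  refine hmain.trans ?_
  have hcard : (S.card : ℝ) ≤ Real.exp (5 * n * Real.log (max k s)) := by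
    calc (S.card : ℝ) ≤ (k : ℝ) ^ (5 * n) := by exact_mod_cast hS
      _ ≤ (max (k : ℝ) s) ^ (5 * n) := pow_le_pow_left₀ hk0.le (le_max_left _ _) _
      _ = _ := by
        rw [← Real.exp_log (lt_max_of_lt_left hk0 : (0 : ℝ) < max (k : ℝ) s), ← Real.exp_nat_mul,
          Real.log_exp]
        push_cast
        rfl
  refine (mul_le_mul_of_nonneg_right hcard (Real.exp_pos _).le).trans ?_
  rw [← Real.exp_add]
  exact Real.exp_le_exp.2 (by linarith)

end

section

variable {K Ω : Type*} [Fintype K] [DecidableEq K] [MeasurableSpace K] [DiscreteMeasurableSpace K]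
  [MeasurableSpace Ω] {μ : Measure Ω} [IsProbabilityMeasure μ]
  {n s k : ℕ} {A : Ω → Fin n → Fin n → K} {θ : Fin n → Fin n → K → ℝ}

/-- Markov's inequality at level exp(5B + C' n log s); since n log s ≤ B, the constant 32(5 + C')
suffices. -/
theorem IsDecoratedGraph.one_sub_exp_le_measureReal_mse_le [NeZero k] (hs : 0 < s) (hn : 0 < n)
    (hk : k ^ 2 ≤ s + n) {diag : Option K}
    {est : (Fin n → Fin n → K) → Fin n → Fin n → K → ℝ}
    (hest : IsLeastSquaresEstimator (shapeParams n s k diag) est)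
    (hθ : θ ∈ shapeParams n s k diag) (hA : IsDecoratedGraph μ A θ) {C' : ℝ} (hC' : 0 < C') :
    1 - Real.exp (-(C' * n * Real.log s)) ≤
      μ.real {ω | mse (est (A ω)) θ ≤ 32 * (5 + C') * ((s : ℝ) * Fintype.card K / (n : ℝ) ^ 2
        + Real.log (max (k : ℝ) (s : ℝ)) / n)} := by
  set B := n * Real.log (max (k : ℝ) s) + s * Fintype.card K with hB
  set G := {ω | mse (est (A ω)) θ ≤ 32 * (5 + C') * ((s : ℝ) * Fintype.card K / (n : ℝ) ^ 2
        + Real.log (max (k : ℝ) (s : ℝ)) / n)}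
  have hn0 : (0 : ℝ) < n := by exact_mod_cast hn
  have hs0 : (0 : ℝ) < s := by exact_mod_cast hs
  have hlog : Real.log s ≤ Real.log (max (k : ℝ) s) := Real.log_le_log hs0 (le_max_right _ _)
  have hsub : Gᶜ ⊆ {ω | Real.exp (5 * B + C' * n * Real.log s)
      ≤ Real.exp (frobSq (est (A ω)) θ / 32)} := by
    intro ω hω
    have h1 : 32 * (5 + C') * ((s : ℝ) * Fintype.card K / (n : ℝ) ^ 2
        + Real.log (max (k : ℝ) (s : ℝ)) / n) < mse (est (A ω)) θ := not_le.1 hω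
    have h2 : 32 * (5 + C') * ((s : ℝ) * Fintype.card K / (n : ℝ) ^ 2
        + Real.log (max (k : ℝ) (s : ℝ)) / n) = 1 / (n : ℝ) ^ 2 * (32 * (5 + C') * B) := by
      rw [hB]; field_simp; ring
    rw [h2] at h1
    have h3 := lt_of_mul_lt_mul_left h1 (by positivity)
    have h4 : n * Real.log s ≤ B := by
      have : (0 : ℝ) ≤ s * Fintype.card K := by positivity
      nlinarith
    have h5 := mul_le_mul_of_nonneg_left h4 hC'.le
    exact Real.exp_le_exp.2 (by linarith)
  have hmarkov := mul_meas_ge_le_integral_of_nonneg (μ := μ)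
    (ae_of_all _ fun ω => (Real.exp_pos (frobSq (est (A ω)) θ / 32)).le)
    (hA.integrable_comp fun a => Real.exp (frobSq (est a) θ / 32))
    (Real.exp (5 * B + C' * n * Real.log s))
  have hbad : μ.real Gᶜ ≤ Real.exp (-(C' * n * Real.log s)) := by
    refine (measureReal_mono hsub).trans (le_of_mul_le_mul_left (hmarkov.trans
      ((hA.integral_exp_frobSq_le hs hn hk hest hθ).trans (le_of_eq ?_))) (Real.exp_pos _))
    rw [← Real.exp_add]
    congr 1
    ring
  have huniv : (1 : ℝ) ≤ μ.real G + μ.real Gᶜ := by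
    have := measureReal_union_le (μ := μ) G Gᶜ
    rwa [Set.union_compl_self, probReal_univ] at this
  linarith

theorem IsDecoratedGraph.integral_mse_le [NeZero k] (hs : 0 < s) (hn : 0 < n)
    (hk : k ^ 2 ≤ s + n) {diag : Option K}
    {est : (Fin n → Fin n → K) → Fin n → Fin n → K → ℝ}
    (hest : IsLeastSquaresEstimator (shapeParams n s k diag) est)
    (hθ : θ ∈ shapeParams n s k diag) (hA : IsDecoratedGraph μ A θ) :
    ∫ ω, mse (est (A ω)) θ ∂μ ≤ 160 * ((s : ℝ) * Fintype.card K / (n : ℝ) ^ 2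
        + Real.log (max (k : ℝ) (s : ℝ)) / n) := by
  set B := n * Real.log (max (k : ℝ) s) + s * Fintype.card K with hB
  have hn0 : (0 : ℝ) < n := by exact_mod_cast hn
  -- The tangent-line bound x ≤ a - 1 + exp(x - a) at a = 5B plays the role of Jensen's inequality;
  -- 160 = 32 · 5.
  have hpt : ∀ ω, mse (est (A ω)) θ ≤ 32 / (n : ℝ) ^ 2 *
      (5 * B - 1 + Real.exp (-(5 * B)) * Real.exp (frobSq (est (A ω)) θ / 32)) := by
    intro ω
    rw [← Real.exp_add]
    have h := Real.add_one_le_exp (-(5 * B) + frobSq (est (A ω)) θ / 32)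
    calc mse (est (A ω)) θ = 32 / (n : ℝ) ^ 2 * (frobSq (est (A ω)) θ / 32) := by
          rw [mse]; ring
      _ ≤ _ := mul_le_mul_of_nonneg_left (by linarith) (by positivity)
  have hexp := hA.integrable_comp fun a => Real.exp (frobSq (est a) θ / 32)
  calc ∫ ω, mse (est (A ω)) θ ∂μ
      ≤ ∫ ω, 32 / (n : ℝ) ^ 2 *
        (5 * B - 1 + Real.exp (-(5 * B)) * Real.exp (frobSq (est (A ω)) θ / 32)) ∂μ :=
        integral_mono (hA.integrable_comp fun a => mse (est a) θ)
          (((integrable_const _).add (hexp.const_mul _)).const_mul _) hpt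
    _ = 32 / (n : ℝ) ^ 2 * (5 * B - 1 + Real.exp (-(5 * B)) *
        ∫ ω, Real.exp (frobSq (est (A ω)) θ / 32) ∂μ) := by
        rw [integral_const_mul, integral_add (integrable_const _) (hexp.const_mul _),
          integral_const_mul]
        simp
    _ ≤ 32 / (n : ℝ) ^ 2 * (5 * B - 1 + Real.exp (-(5 * B)) * Real.exp (5 * B)) := by
        have := hA.integral_exp_frobSq_le hs hn hk hest hθ
        gcongr
    _ = _ := by
        rw [← Real.exp_add, hB]
        simp only [neg_add_cancel, Real.exp_zero, sub_add_cancel]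
        field_simp
        ring

end

theorem theorem1 :
    (∀ C' : ℝ, 0 < C' → ∃ C : ℝ, 0 < C ∧
      ∀ (K : Type*) [Fintype K] [DecidableEq K] [MeasurableSpace K] [DiscreteMeasurableSpace K]
        (n s k : ℕ) [NeZero k] (_ : 0 < s) (_ : max 0 ((k : ℤ) ^ 2 - (s : ℤ)) < (n : ℤ))
        (diag : Option K) (est : (Fin n → Fin n → K) → Fin n → Fin n → K → ℝ),
        IsLeastSquaresEstimator (shapeParams n s k diag) est →
        ∀ θ ∈ shapeParams n s k diag,
        ∀ (Ω : Type*) [MeasurableSpace Ω] (μ : Measure Ω) [IsProbabilityMeasure μ]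
          (A : Ω → Fin n → Fin n → K), IsDecoratedGraph μ A θ →
          1 - Real.exp (-(C' * n * Real.log s)) ≤
            μ.real {ω | mse (est (A ω)) θ ≤
              C * ((s : ℝ) * Fintype.card K / (n : ℝ) ^ 2
                + Real.log (max (k : ℝ) (s : ℝ)) / n)}) ∧
    (∃ C₁ : ℝ, 0 < C₁ ∧
      ∀ (K : Type*) [Fintype K] [DecidableEq K] [MeasurableSpace K] [DiscreteMeasurableSpace K]
        (n s k : ℕ) [NeZero k] (_ : 0 < s) (_ : max 0 ((k : ℤ) ^ 2 - (s : ℤ)) < (n : ℤ))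
        (diag : Option K) (est : (Fin n → Fin n → K) → Fin n → Fin n → K → ℝ),
        IsLeastSquaresEstimator (shapeParams n s k diag) est →
        ∀ θ ∈ shapeParams n s k diag,
        ∀ (Ω : Type*) [MeasurableSpace Ω] (μ : Measure Ω) [IsProbabilityMeasure μ]
          (A : Ω → Fin n → Fin n → K), IsDecoratedGraph μ A θ →
          ∫ ω, mse (est (A ω)) θ ∂μ ≤
            C₁ * ((s : ℝ) * Fintype.card K / (n : ℝ) ^ 2
              + Real.log (max (k : ℝ) (s : ℝ)) / n)) := by
  have hdim : ∀ n s k : ℕ, max 0 ((k : ℤ) ^ 2 - (s : ℤ)) < (n : ℤ) → 0 < n ∧ k ^ 2 ≤ s + n := by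
    intro n s k h
    rw [max_lt_iff] at h
    refine ⟨by exact_mod_cast h.1, ?_⟩
    zify
    linarith [h.2]
  refine ⟨fun C' hC' => ⟨32 * (5 + C'), by positivity, ?_⟩, 160, by norm_num, ?_⟩
  · intro K _ _ _ _ n s k _ hs hn diag est hest θ hθ Ω _ μ _ A hA
    obtain ⟨hn, hk⟩ := hdim n s k hn
    exact hA.one_sub_exp_le_measureReal_mse_le hs hn hk hest hθ hC'
  · intro K _ _ _ _ n s k _ hs hn diag est hest θ hθ Ω _ μ _ A hA
    obtain ⟨hn, hk⟩ := hdim n s k hn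
    exact hA.integral_mse_le hs hn hk hest hθ
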